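/- **Theorem 2 (Multivariable Convex Trace Functions).** Let $I_1,\dots,I_n\subset\mathbb R$ be intervals and let $f$ be a continuous convex real function on the cube $I=I_1\times\cdots\times I_n\subset\mathbb R^n$. Let $A$ be a $C^*$-algebra and let $A_1,\dots,A_n$ be mutually commuting $C^*$-subalgebras of $A$, i.e. $ab=ba$ whenever $a\in A_i$, $b\in A_j$ and $i\neq j$. If $A$ has no unit, assume $f(0)=0$. Let $(A_i)_{sa}^{I_i}$ be the set of self-adjoint elements of $A_i$ whose spectra are contained in $I_i$; spectra are taken in $A$ if $A$ is unital (the $A_i$ need not contain the unit), and in the unitization of $A$ otherwise. For $\underline x=(x_1,\dots,x_n)$ with $x_i\in(A_i)_{sa}^{I_i}$ for each $i$, let $f(\underline x)\in A$ be given by the joint continuous functional calculus, i.e. the unital $*$-homomorphism from the continuous functions on the product of the spectra of the $x_i$ into $A$ (or into the unitization of $A$, if $A$ has no unit) that sends the $i$-th coordinate function to $x_i$. A trace on $A$ is a map $\tau\colon A_+\to[0,\infty]$ that is additive and positively homogeneous (with $0\cdot\infty=0$) and satisfies $\tau(x^*x)=\tau(xx^*)$ for all $x\in A$. It is finite if $\tau(a)<\infty$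 for all $a\in A_+$, in which case it is extended to self-adjoint elements by $\tau(a)=\tau(a_+)-\tau(a_-)$; it is densely defined if $\{a\in A_+:\tau(a)<\infty\}$ is dense in $A_+$. 1. If $\tau$ is a finite trace on $A$, then the function $(x_1,\dots,x_n)\mapsto\tau(f(x_1,\dots,x_n))\in\mathbb R$ is convex on the (convex) set of $n$-tuples $\bigoplus_i (A_i)_{sa}^{I_i}$. 2. If $\tau$ is a densely defined trace on $A$ that is lower semicontinuous on $A_+$, and $f\ge 0$ on $I$, then the function $(x_1,\dots,x_n)\mapsto\tau(f(x_1,\dots,x_n))\in[0,\infty]$ is convex on $\bigoplus_i (A_i)_{sa}^{I_i}$; it may take the value $\infty$. -/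

import Mathlib

open scoped ENNReal NNReal

noncomputable section

namespace TraceConvexity

/-! ### Joint continuous functional calculus -/

section Calculus

variable {n : ℕ} {A : Type*} [CStarAlgebra A]

/-- The product of the (real) spectra of the elements `x 0, …, x (n - 1)`. -/
def specBox (x : Fin n → A) : Set (Fin n → ℝ) :=
  Set.univ.pi fun i => spectrum ℝ (x i)

/-- The `i`-th coordinate function `t ↦ t i` on the product of the spectra. -/
def coord (x : Fin n → A) (i : Fin n) : C(specBox x, ℂ) where
  toFun t := ((t : Fin n → ℝ) i : ℂ)
  continuous_toFun := Complex.continuous_ofReal.comp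
    ((continuous_apply i).comp continuous_subtype_val)

/-- The restriction to the product of the spectra of a real function that is continuous there. -/
def restrictBox (x : Fin n → A) (f : (Fin n → ℝ) → ℝ) (hf : ContinuousOn f (specBox x)) :
    C(specBox x, ℂ) where
  toFun t := (f t : ℂ)
  continuous_toFun := Complex.continuous_ofReal.comp hf.domRestrict

open Classical in
/-- The element `f(x₁, …, xₙ)` of a unital C⋆-algebra, for commuting self-adjoint `xᵢ`: the image
of `f` under the unital `⋆`-homomorphism from the continuous functions on the product of the
spectra that sends the `i`-th coordinate function to `xᵢ`. This homomorphism exists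
(`exists_starAlgHom`) and is unique (`starAlgHom_ext`). -/
def jointCFC (x : Fin n → A) (f : (Fin n → ℝ) → ℝ) : A :=
  if h : (∃ φ : C(specBox x, ℂ) →⋆ₐ[ℂ] A, ∀ i, φ (coord x i) = x i) ∧
      ContinuousOn f (specBox x) then
    h.1.choose (restrictBox x f h.2)
  else 0

theorem isCompact_specBox (x : Fin n → A) : IsCompact (specBox x) :=
  isCompact_univ_pi fun i => spectrum.isCompact (𝕜 := ℝ) (x i)

open scoped CStarAlgebra in
theorem starAlgHom_ext {D : Type*} [CStarAlgebra D] (x : Fin n → A)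
    {φ ψ : C(specBox x, ℂ) →⋆ₐ[ℂ] D} (h : ∀ i, φ (coord x i) = ψ (coord x i)) : φ = ψ := by
  have : CompactSpace (specBox x) := isCompact_iff_compactSpace.mp (isCompact_specBox x)
  have hsep : (StarAlgebra.adjoin ℂ (Set.range (coord x))).SeparatesPoints := by
    intro s t hst
    have : ∃ i, (s : Fin n → ℝ) i ≠ (t : Fin n → ℝ) i := by
      by_contra hcon
      push Not at hcon
      exact hst (Subtype.ext (funext hcon))
    obtain ⟨i, hi⟩ := this
    refine ⟨coord x i, ⟨coord x i, StarAlgebra.subset_adjoin _ _ ⟨i, rfl⟩, rfl⟩, ?_⟩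
    simpa [coord] using hi
  have htop := ContinuousMap.starSubalgebra_topologicalClosure_eq_top_of_separatesPoints _ hsep
  have hφ : Continuous φ := map_continuous φ
  have hψ : Continuous ψ := map_continuous ψ
  have hle : StarAlgebra.adjoin ℂ (Set.range (coord x)) ≤ StarAlgHom.equalizer φ ψ := by
    apply StarAlgebra.adjoin_le
    rintro _ ⟨i, rfl⟩
    exact h i
  have hcl : (StarAlgebra.adjoin ℂ (Set.range (coord x))).topologicalClosure ≤
      StarAlgHom.equalizer φ ψ :=
    StarSubalgebra.topologicalClosure_minimal hle (isClosed_eq hφ hψ)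
  ext1 g
  have : g ∈ (StarAlgebra.adjoin ℂ (Set.range (coord x))).topologicalClosure := by
    rw [htop]; trivial
  exact hcl this

theorem exists_starAlgHom (x : Fin n → A) (hsa : ∀ i, IsSelfAdjoint (x i))
    (hcomm : ∀ i j, Commute (x i) (x j)) :
    ∃ φ : C(specBox x, ℂ) →⋆ₐ[ℂ] A, ∀ i, φ (coord x i) = x i := by
  let S₀ : StarSubalgebra ℂ A := StarAlgebra.adjoin ℂ (Set.range x)
  have hcS : IsMulCommutative S₀ := StarAlgebra.isMulCommutative_adjoin ℂ
    (by rintro _ ⟨i, rfl⟩ _ ⟨j, rfl⟩; exact hcomm i j)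
    (by rintro _ ⟨i, rfl⟩ _ ⟨j, rfl⟩; rw [(hsa j).star_eq]; exact hcomm i j)
  let S : StarSubalgebra ℂ A := S₀.topologicalClosure
  have hmc : ∀ a b : S₀, a * b = b * a := fun a b => mul_comm' a b
  have hS : IsClosed (S : Set A) := StarSubalgebra.isClosed_topologicalClosure _
  let cS : CStarAlgebra S := inferInstance
  let : CommCStarAlgebra S :=
    { cS with mul_comm := (StarSubalgebra.commRingTopologicalClosure S₀ hmc).mul_comm }
  have hx : ∀ i, x i ∈ S := fun i =>
    S₀.le_topologicalClosure (StarAlgebra.subset_adjoin _ _ ⟨i, rfl⟩)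
  have hχ : ∀ (χ : WeakDual.characterSpace ℂ S) i,
      ((χ ⟨x i, hx i⟩).re : ℂ) = χ ⟨x i, hx i⟩ := by
    intro χ i
    have h1 : star (⟨x i, hx i⟩ : S) = ⟨x i, hx i⟩ := Subtype.ext (hsa i).star_eq
    have h2 : star (χ ⟨x i, hx i⟩) = χ ⟨x i, hx i⟩ := by rw [← map_star, h1]
    exact Complex.conj_eq_iff_re.mp h2
  have hmem : ∀ (χ : WeakDual.characterSpace ℂ S),
      (fun i => (χ ⟨x i, hx i⟩).re) ∈ specBox x := by
    intro χ i _
    have h1 : χ ⟨x i, hx i⟩ ∈ spectrum ℂ (⟨x i, hx i⟩ : S) :=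
      WeakDual.CharacterSpace.apply_mem_spectrum χ _
    rw [StarSubalgebra.spectrum_eq, ← hχ χ i] at h1
    exact (spectrum.algebraMap_mem_iff ℂ).mp h1
  let q : C(WeakDual.characterSpace ℂ S, specBox x) :=
    { toFun := fun χ => ⟨_, hmem χ⟩
      continuous_toFun := by
        refine Continuous.subtype_mk (continuous_pi fun i => ?_) _
        exact Complex.continuous_re.comp (WeakDual.gelfandTransform ℂ S ⟨x i, hx i⟩).continuous }
  refine ⟨(S.subtype.comp ((gelfandStarTransform S).symm : _ →⋆ₐ[ℂ] S)).comp
    (q.compStarAlgHom' ℂ ℂ), fun i => ?_⟩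
  have : (q.compStarAlgHom' ℂ ℂ) (coord x i) = gelfandStarTransform S ⟨x i, hx i⟩ := by
    ext χ
    exact hχ χ i
  simp [this]

theorem jointCFC_eq (x : Fin n → A) (f : (Fin n → ℝ) → ℝ) (hf : ContinuousOn f (specBox x))
    (φ : C(specBox x, ℂ) →⋆ₐ[ℂ] A) (hφ : ∀ i, φ (coord x i) = x i) :
    jointCFC x f = φ (restrictBox x f hf) := by
  have h : (∃ φ : C(specBox x, ℂ) →⋆ₐ[ℂ] A, ∀ i, φ (coord x i) = x i) ∧
      ContinuousOn f (specBox x) := ⟨⟨φ, hφ⟩, hf⟩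
  rw [jointCFC, dif_pos h, starAlgHom_ext x (φ := h.1.choose) (ψ := φ)
    fun i => (h.1.choose_spec i).trans (hφ i).symm]

end Calculus

/-- The element `f(x₁, …, xₙ)` of a C⋆-algebra that need not have a unit, for commuting
self-adjoint `xᵢ` and `f 0 = 0`: it is computed in the unitization, where its scalar part is
`f 0 = 0` (`fst_jointCFC_inr`), and so lies in `A`. -/
def jointCFCₙ {n : ℕ} {A : Type*} [NonUnitalCStarAlgebra A] (x : Fin n → A)
    (f : (Fin n → ℝ) → ℝ) : A :=
  (jointCFC (fun i => (x i : Unitization ℂ A)) f).snd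

theorem fst_jointCFC_inr {n : ℕ} {A : Type*} [NonUnitalCStarAlgebra A] (x : Fin n → A)
    (hsa : ∀ i, IsSelfAdjoint (x i)) (hcomm : ∀ i j, Commute (x i) (x j))
    (f : (Fin n → ℝ) → ℝ)
    (hf : ContinuousOn f (specBox fun i => (x i : Unitization ℂ A))) :
    (jointCFC (fun i => (x i : Unitization ℂ A)) f).fst = (f 0 : ℂ) := by
  obtain ⟨φ, hφ⟩ := exists_starAlgHom (fun i => (x i : Unitization ℂ A))
    (fun i => (hsa i).inr ℂ)
    (fun i j => by
      have := congrArg (Unitization.inr (R := ℂ)) (hcomm i j).eq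
      simpa [Commute, SemiconjBy] using this)
  have h0 : (0 : Fin n → ℝ) ∈ specBox fun i => (x i : Unitization ℂ A) := by
    intro i _
    change (0 : ℝ) ∈ spectrum ℝ (x i : Unitization ℂ A)
    rw [← Unitization.quasispectrum_eq_spectrum_inr' ℝ ℂ (x i)]
    exact quasispectrum.zero_mem ℝ (x i)
  let p : Unitization ℂ A →⋆ₐ[ℂ] ℂ :=
    { Unitization.fstHom ℂ A with map_star' := fun a => Unitization.fst_star a }
  let ev : C(specBox fun i => (x i : Unitization ℂ A), ℂ) →⋆ₐ[ℂ] ℂ :=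
    { toFun := fun g => g ⟨0, h0⟩
      map_one' := rfl
      map_mul' := fun _ _ => rfl
      map_zero' := rfl
      map_add' := fun _ _ => rfl
      commutes' := fun _ => rfl
      map_star' := fun _ => rfl }
  have hev : p.comp φ = ev := by
    refine starAlgHom_ext _ fun i => ?_
    change (φ (coord _ i)).fst = ((0 : ℝ) : ℂ)
    rw [hφ i]
    simp
  rw [jointCFC_eq _ f hf φ hφ]
  exact DFunLike.congr_fun hev (restrictBox _ f hf)

/-! ### Traces -/

section Traces

variable {A : Type*} [NonUnitalCStarAlgebra A] [PartialOrder A]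

/-- A trace on `A`: an additive, positively homogeneous map `τ` from the positive cone of `A` to
`[0, ∞]` with `τ (x⋆ x) = τ (x x⋆)` for all `x`. Only the values of `τ` on positive elements
matter. -/
structure IsTrace (τ : A → ℝ≥0∞) : Prop where
  map_add : ∀ a b : A, 0 ≤ a → 0 ≤ b → τ (a + b) = τ a + τ b
  map_smul : ∀ (c : ℝ≥0) (a : A), 0 ≤ a → τ (c • a) = c * τ a
  map_star_mul_self : ∀ x : A, τ (star x * x) = τ (x * star x)

/-- `τ` is finite on the whole positive cone. -/
def IsFiniteTrace (τ : A → ℝ≥0∞) : Prop :=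
  ∀ a : A, 0 ≤ a → τ a < ∞

/-- The positive elements with finite trace are dense in the positive cone. -/
def IsDenselyDefined (τ : A → ℝ≥0∞) : Prop :=
  {a : A | 0 ≤ a} ⊆ closure {a : A | 0 ≤ a ∧ τ a < ∞}

/-- The real-valued extension of a finite trace to the self-adjoint elements `a = a⁺ - a⁻`. -/
def realTrace [StarOrderedRing A] (τ : A → ℝ≥0∞) (a : A) : ℝ :=
  (τ a⁺).toReal - (τ a⁻).toReal

end Traces

/-! ### Tuples from commuting subalgebras -/

/-- Elements of `S i` and of `S j` commute whenever `i ≠ j`. -/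
def MutuallyCommuting {n : ℕ} {A : Type*} [NonUnitalCStarAlgebra A]
    (S : Fin n → NonUnitalStarSubalgebra ℂ A) : Prop :=
  ∀ i j, i ≠ j → ∀ a ∈ S i, ∀ b ∈ S j, Commute a b

/-- The tuples of self-adjoint elements `x i ∈ S i` with spectrum contained in `I i`, in a unital
C⋆-algebra; the `S i` need not contain the unit. -/
def saTuples {n : ℕ} {A : Type*} [CStarAlgebra A] (S : Fin n → NonUnitalStarSubalgebra ℂ A)
    (I : Fin n → Set ℝ) : Set (Fin n → A) :=
  {x | ∀ i, x i ∈ S i ∧ IsSelfAdjoint (x i) ∧ spectrum ℝ (x i) ⊆ I i}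

/-- The same in a C⋆-algebra that need not have a unit: `quasispectrum ℝ (x i)` is the spectrum of
`x i` in the unitization. -/
def saTuplesₙ {n : ℕ} {A : Type*} [NonUnitalCStarAlgebra A]
    (S : Fin n → NonUnitalStarSubalgebra ℂ A) (I : Fin n → Set ℝ) : Set (Fin n → A) :=
  {x | ∀ i, x i ∈ S i ∧ IsSelfAdjoint (x i) ∧ quasispectrum ℝ (x i) ⊆ I i}

end TraceConvexity

end

/-!
A continuous convex `f` on a closed box is the supremum of its affine minorants `l`, and on affine
functions the joint calculus is linear in the tuple. Hence `l(z) ≤ p := a • f(x) + b • f(y)` for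
`z = a • x + b • y`, although `f(z) ≤ p` itself may fail. On the compact product of the spectra of
`z`, the cut-off `(f - ε) ⊔ 0` lies locally below such an `l` (or below `0`), so a partition of
unity `∑ g k ^ 2 = 1` gives `((f - ε) ⊔ 0)(z) ≤ ∑ g k(z) * p * g k(z)`. By the trace property the
right-hand side has the same trace as `p`, and lower semicontinuity lets `ε` tend to `0`.

A finite trace is continuous, and on a compact box `f` becomes nonnegative after adding a constant.
Without a unit one passes to the unitization: a lower semicontinuous trace is extended by `∞`, and a
finite one by `λ + a ↦ C * λ + τ(a)` with `C` a bound for `τ`, which is positive because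
`0 ≤ λ + a` forces `‖a⁻‖ ≤ λ`.
-/

open Topology

noncomputable section

namespace TraceConvexity

/-! ### Comparing traces by partitions of unity -/

theorem exists_sum_mul_self_eq_one_and_le {X : Type*} [TopologicalSpace X] [CompactSpace X]
    [T2Space X] {L : Set C(X, ℝ)} {F : C(X, ℝ)} (hF : ∀ t, ∃ l ∈ L, ∀ᶠ s in 𝓝 t, F s ≤ l s) :
    ∃ (T : Finset X) (l g : T → C(X, ℝ)), (∀ k, l k ∈ L) ∧ ∑ k, g k * g k = 1 ∧
      F ≤ ∑ k, g k * l k * g k := by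
  choose l hlL hFl using hF
  choose U hUF hU hmem using fun t => eventually_nhds_iff.mp (hFl t)
  obtain ⟨T, hT⟩ := isCompact_univ.elim_finite_subcover U hU fun t _ =>
    Set.mem_iUnion.mpr ⟨t, hmem t⟩
  obtain ⟨ρ, hρ⟩ := PartitionOfUnity.exists_isSubordinate_of_locallyFinite isClosed_univ
    (fun k : T => U k) (fun k => hU k) (locallyFinite_of_finite _)
    (by simpa only [Set.iUnion_subtype] using hT)
  have hsum : ∀ t, ∑ k, ρ k t = 1 := fun t => by
    rw [← finsum_eq_sum_of_fintype, ρ.sum_eq_one (Set.mem_univ t)]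
  let g : T → C(X, ℝ) := fun k => ⟨fun t => √(ρ k t), (ρ k).continuous.sqrt⟩
  have hg : ∀ k t, g k t * g k t = ρ k t := fun k t => Real.mul_self_sqrt (ρ.nonneg k t)
  refine ⟨T, fun k => l k, g, fun k => hlL k, ?_, fun t => ?_⟩
  · ext t
    simp only [ContinuousMap.sum_apply, ContinuousMap.mul_apply, hg, hsum, ContinuousMap.one_apply]
  · have hle : ∀ k : T, ρ k t * F t ≤ ρ k t * l k t := fun k => by
      obtain h0 | h0 := eq_or_ne (ρ k t) 0
      · simp only [h0, zero_mul, le_refl]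
      · exact mul_le_mul_of_nonneg_left (hUF k t (hρ k (subset_tsupport _ h0))) (ρ.nonneg k t)
    calc F t = ∑ k, ρ k t * F t := by rw [← Finset.sum_mul, hsum, one_mul]
      _ ≤ ∑ k, ρ k t * l k t := Finset.sum_le_sum fun k _ => hle k
      _ = (∑ k, g k * l k * g k) t := by
        simp only [ContinuousMap.sum_apply, ContinuousMap.mul_apply, ← hg]
        exact Finset.sum_congr rfl fun k _ => by ring

theorem tendsto_map_sub_algebraMap_sup_zero {A : Type*} [CStarAlgebra A] [PartialOrder A]
    [StarOrderedRing A] {X : Type*} [TopologicalSpace X]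
    (Φ : C(X, ℝ) →⋆ₐ[ℝ] A) {f : C(X, ℝ)} (hf : 0 ≤ f) :
    Filter.Tendsto (fun ε => Φ ((f - algebraMap ℝ _ ε) ⊔ 0)) (𝓝[>] 0) (𝓝 (Φ f)) := by
  have hbound : ∀ ε > 0, ‖Φ ((f - algebraMap ℝ _ ε) ⊔ 0) - Φ f‖ ≤ ‖algebraMap ℝ A ε‖ := by
    intro ε hε
    have hε : 0 ≤ algebraMap ℝ C(X, ℝ) ε := algebraMap_nonneg _ hε.le
    have hle : (f - algebraMap ℝ _ ε) ⊔ 0 ≤ f := sup_le (sub_le_self f hε) hf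
    rw [norm_sub_rev, ← map_sub, ← AlgHomClass.commutes Φ ε]
    exact CStarAlgebra.norm_le_norm_of_nonneg_of_le (map_nonneg Φ (sub_nonneg.mpr hle))
      (OrderHomClass.mono Φ (sub_le_comm.mp le_sup_left))
  have hnorm : Filter.Tendsto (fun ε => ‖algebraMap ℝ A ε‖) (𝓝[>] 0) (𝓝 0) :=
    ((continuous_algebraMap ℝ A).norm.tendsto' 0 0 (by rw [map_zero, norm_zero])).mono_left
      nhdsWithin_le_nhds
  rw [tendsto_iff_norm_sub_tendsto_zero]
  exact squeeze_zero' (.of_forall fun ε => norm_nonneg _)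
    (eventually_mem_nhdsWithin.mono hbound) hnorm

namespace IsTrace

section NonUnital

variable {A : Type*} [NonUnitalCStarAlgebra A] [PartialOrder A] {τ : A → ℝ≥0∞}

protected theorem map_zero (hτ : IsTrace τ) : τ 0 = 0 := by
  simpa only [zero_smul, ENNReal.coe_zero, zero_mul] using hτ.map_smul 0 0 le_rfl

variable [StarOrderedRing A]

theorem mono (hτ : IsTrace τ) {a b : A} (ha : 0 ≤ a) (hab : a ≤ b) : τ a ≤ τ b :=
  calc τ a ≤ τ a + τ (b - a) := le_self_add
    _ = τ b := by rw [← hτ.map_add a (b - a) ha (sub_nonneg.mpr hab), add_sub_cancel]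

protected theorem map_sum (hτ : IsTrace τ) {ι : Type*} (s : Finset ι) {a : ι → A}
    (ha : ∀ k ∈ s, 0 ≤ a k) :
    τ (∑ k ∈ s, a k) = ∑ k ∈ s, τ (a k) := by
  classical
  induction s using Finset.induction_on with
  | empty => simpa only [Finset.sum_empty] using hτ.map_zero
  | insert j s hj ih =>
    rw [Finset.forall_mem_insert] at ha
    rw [Finset.sum_insert hj, Finset.sum_insert hj, hτ.map_add _ _ ha.1 (Finset.sum_nonneg ha.2),
      ih ha.2]

end NonUnital

section Unital

variable {A : Type*} [CStarAlgebra A] [PartialOrder A] [StarOrderedRing A] {τ : A → ℝ≥0∞}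

theorem map_sum_star_mul_mul (hτ : IsTrace τ) {ι : Type*} (s : Finset ι) {g : ι → A}
    (hg : ∑ k ∈ s, g k * star (g k) = 1) {p : A} (hp : 0 ≤ p) :
    τ (∑ k ∈ s, star (g k) * p * g k) = τ p := by
  obtain ⟨q, rfl⟩ := CStarAlgebra.nonneg_iff_eq_star_mul_self.mp hp
  have hcyc : ∀ k, τ (star (g k) * (star q * q) * g k) = τ (q * (g k * star (g k)) * star q) :=
    fun k => by simpa only [star_mul, mul_assoc] using hτ.map_star_mul_self (q * g k)
  calc τ (∑ k ∈ s, star (g k) * (star q * q) * g k)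
      = ∑ k ∈ s, τ (q * (g k * star (g k)) * star q) := by
        rw [hτ.map_sum s fun k _ => star_left_conjugate_nonneg hp (g k)]
        simp only [hcyc]
    _ = τ (q * (∑ k ∈ s, g k * star (g k)) * star q) := by
        rw [Finset.mul_sum, Finset.sum_mul,
          hτ.map_sum s fun k _ => star_right_conjugate_nonneg (mul_star_self_nonneg (g k)) q]
    _ = τ (star q * q) := by rw [hg, mul_one, hτ.map_star_mul_self]

variable {X : Type*} [TopologicalSpace X] [CompactSpace X] [T2Space X] {L : Set C(X, ℝ)}
  {Φ : C(X, ℝ) →⋆ₐ[ℝ] A} {p : A}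

theorem map_le_of_eventually_le (hτ : IsTrace τ) (hp : 0 ≤ p) (hL : ∀ l ∈ L, Φ l ≤ p)
    {F : C(X, ℝ)} (hF₀ : 0 ≤ F) (hF : ∀ t, ∃ l ∈ L, ∀ᶠ s in 𝓝 t, F s ≤ l s) :
    τ (Φ F) ≤ τ p := by
  obtain ⟨T, l, g, hl, hg, hFg⟩ := exists_sum_mul_self_eq_one_and_le hF
  have hstar : ∀ k, star (Φ (g k)) = Φ (g k) := fun k => by rw [← map_star, star_trivial]
  have hone : ∑ k, Φ (g k) * star (Φ (g k)) = 1 := by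
    simp only [hstar, ← map_mul, ← map_sum, hg, map_one]
  calc τ (Φ F) ≤ τ (∑ k, star (Φ (g k)) * p * Φ (g k)) := by
        refine hτ.mono (map_nonneg Φ hF₀) ?_
        calc Φ F ≤ Φ (∑ k, g k * l k * g k) := OrderHomClass.mono Φ hFg
          _ = ∑ k, star (Φ (g k)) * Φ (l k) * Φ (g k) := by simp only [map_sum, map_mul, hstar]
          _ ≤ ∑ k, star (Φ (g k)) * p * Φ (g k) := Finset.sum_le_sum fun k _ =>
            star_left_conjugate_le_conjugate (hL _ (hl k)) _
    _ = τ p := hτ.map_sum_star_mul_mul _ hone hp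

theorem map_le_of_forall_exists_lt (hτ : IsTrace τ) (hlsc : LowerSemicontinuousOn τ {a | 0 ≤ a})
    (hp : 0 ≤ p) (hL : ∀ l ∈ L, Φ l ≤ p) {f : C(X, ℝ)} (hf₀ : 0 ≤ f)
    (hf : ∀ t, ∀ r < f t, ∃ l ∈ L, r < l t) : τ (Φ f) ≤ τ p := by
  let F : ℝ → C(X, ℝ) := fun ε => (f - algebraMap ℝ _ ε) ⊔ 0
  have hF_le : ∀ ε > 0, τ (Φ (F ε)) ≤ τ p := by
    refine fun ε hε => hτ.map_le_of_eventually_le (L := insert 0 L) hp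
      (Set.forall_mem_insert.mpr ⟨by rwa [map_zero], hL⟩) le_sup_right fun t => ?_
    obtain hlt | hle := lt_or_ge (f t) ε
    · refine ⟨0, Set.mem_insert _ _, ?_⟩
      filter_upwards [f.continuous.continuousAt.eventually_lt_const hlt] with s hs
      exact sup_le (sub_nonpos.mpr hs.le) le_rfl
    · obtain ⟨l, hl, hlt⟩ := hf t (f t - ε) (sub_lt_self _ hε)
      refine ⟨l, Set.mem_insert_of_mem _ hl, ?_⟩
      have hFl : F ε t < l t := (sup_of_le_left (sub_nonneg.mpr hle)).trans_lt hlt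
      filter_upwards [(F ε).continuous.continuousAt.eventually_lt l.continuous.continuousAt hFl]
        with s hs using hs.le
  have htendsto : Filter.Tendsto (fun ε => Φ (F ε)) (𝓝[>] 0) (𝓝[{a | 0 ≤ a}] Φ f) :=
    tendsto_nhdsWithin_iff.mpr ⟨tendsto_map_sub_algebraMap_sup_zero Φ hf₀,
      .of_forall fun ε => map_nonneg Φ le_sup_right⟩
  refine le_of_forall_lt fun r hr => ?_
  obtain ⟨ε, hrε, hε⟩ := ((htendsto.eventually (hlsc _ (map_nonneg Φ hf₀) r hr)).and
    self_mem_nhdsWithin).exists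
  exact hrε.trans_le (hF_le ε hε)

end Unital
end IsTrace

/-! ### Affine functions in the joint calculus -/

section Calculus

variable {n : ℕ}

/-- A commuting tuple of self-adjoint elements: the tuples on which the joint functional calculus
is available. -/
structure IsCommSelfAdjoint {A : Type*} [NonUnitalCStarAlgebra A] (x : Fin n → A) : Prop where
  isSelfAdjoint : ∀ i, IsSelfAdjoint (x i)
  commute : ∀ i j, Commute (x i) (x j)

namespace IsCommSelfAdjoint

variable {A : Type*} [CStarAlgebra A] {x y : Fin n → A} {f g : (Fin n → ℝ) → ℝ}

/-- The joint functional calculus of a commuting self-adjoint tuple, as a homomorphism on the real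
continuous functions on the product of the spectra. -/
def cfcHom (hx : IsCommSelfAdjoint x) : C(specBox x, ℝ) →⋆ₐ[ℝ] A :=
  ((exists_starAlgHom x hx.isSelfAdjoint hx.commute).choose.restrictScalars ℝ).comp
    (ContinuousMap.realToRCLikeStarAlgHom (specBox x) ℂ)

theorem jointCFC_eq_cfcHom (hx : IsCommSelfAdjoint x) (hf : ContinuousOn f (specBox x)) :
    jointCFC x f = hx.cfcHom ⟨_, hf.domRestrict⟩ :=
  jointCFC_eq x f hf _ (exists_starAlgHom x hx.isSelfAdjoint hx.commute).choose_spec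

theorem isSelfAdjoint_jointCFC (hx : IsCommSelfAdjoint x) (hf : ContinuousOn f (specBox x)) :
    IsSelfAdjoint (jointCFC x f) := by
  rw [hx.jointCFC_eq_cfcHom hf]
  exact (IsSelfAdjoint.all _).map hx.cfcHom

theorem jointCFC_add (hx : IsCommSelfAdjoint x) (hf : ContinuousOn f (specBox x))
    (hg : ContinuousOn g (specBox x)) :
    jointCFC x (fun t => f t + g t) = jointCFC x f + jointCFC x g := by
  rw [hx.jointCFC_eq_cfcHom hf, hx.jointCFC_eq_cfcHom hg, hx.jointCFC_eq_cfcHom (hf.fun_add hg),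
    ← map_add]
  rfl

theorem jointCFC_const (hx : IsCommSelfAdjoint x) (c : ℝ) :
    jointCFC x (fun _ => c) = algebraMap ℝ A c := by
  rw [hx.jointCFC_eq_cfcHom continuousOn_const, ← AlgHomClass.commutes hx.cfcHom]
  rfl

theorem jointCFC_coord (hx : IsCommSelfAdjoint x) (i : Fin n) :
    jointCFC x (fun t => t i) = x i := by
  have hφ := (exists_starAlgHom x hx.isSelfAdjoint hx.commute).choose_spec
  rw [jointCFC_eq x _ (continuous_apply i).continuousOn _ hφ]
  exact hφ i

theorem jointCFC_linear (hx : IsCommSelfAdjoint x) (l : (Fin n → ℝ) →L[ℝ] ℝ) :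
    jointCFC x l = ∑ i, l (Pi.single i 1) • x i := by
  let coordR : Fin n → C(specBox x, ℝ) := fun i =>
    ⟨(specBox x).domRestrict fun t => t i, (continuous_apply i).continuousOn.domRestrict⟩
  have hl : (⟨_, l.continuous.continuousOn.domRestrict⟩ : C(specBox x, ℝ)) =
      ∑ i, l (Pi.single i 1) • coordR i := by
    ext t
    change l t.1 = _
    conv_lhs => rw [← Finset.univ_sum_single t.1, map_sum]
    rw [ContinuousMap.sum_apply]
    refine Finset.sum_congr rfl fun i _ => ?_
    change l (Pi.single i (t.1 i)) = l (Pi.single i 1) * t.1 i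
    rw [mul_comm, ← smul_eq_mul (t.1 i), ← map_smul, ← Pi.single_smul, smul_eq_mul, mul_one]
  have hcoord : ∀ i, hx.cfcHom (coordR i) = x i := fun i => by
    rw [← hx.jointCFC_coord i, hx.jointCFC_eq_cfcHom (continuous_apply i).continuousOn]
  simp only [hx.jointCFC_eq_cfcHom l.continuous.continuousOn, hl, map_sum, map_smul, hcoord]

theorem jointCFC_affine_smul_add_smul (hx : IsCommSelfAdjoint x)
    (hy : IsCommSelfAdjoint y) {a b : ℝ≥0} (hz : IsCommSelfAdjoint (a • x + b • y))
    (hab : a + b = 1) (l : (Fin n → ℝ) →L[ℝ] ℝ) (c : ℝ) :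
    jointCFC (a • x + b • y) (fun t => l t + c) =
      a • jointCFC x (fun t => l t + c) + b • jointCFC y (fun t => l t + c) := by
  have haff : ∀ {w : Fin n → A}, IsCommSelfAdjoint w →
      jointCFC w (fun t => l t + c) = ∑ i, l (Pi.single i 1) • w i + algebraMap ℝ A c :=
    fun hw => by
      rw [hw.jointCFC_add l.continuous.continuousOn continuousOn_const, hw.jointCFC_linear,
        hw.jointCFC_const]
  have hc : algebraMap ℝ A c = a • algebraMap ℝ A c + b • algebraMap ℝ A c := by
    rw [← add_smul, hab, one_smul]
  rw [haff hx, haff hy, haff hz]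
  conv_lhs => rw [hc]
  simp only [Pi.add_apply, Pi.smul_apply, smul_add, Finset.sum_add_distrib, Finset.smul_sum,
    smul_comm (l _)]
  abel

variable [PartialOrder A] [StarOrderedRing A]

theorem jointCFC_mono (hx : IsCommSelfAdjoint x) (hf : ContinuousOn f (specBox x))
    (hg : ContinuousOn g (specBox x)) (hfg : ∀ t ∈ specBox x, f t ≤ g t) :
    jointCFC x f ≤ jointCFC x g := by
  rw [hx.jointCFC_eq_cfcHom hf, hx.jointCFC_eq_cfcHom hg]
  exact OrderHomClass.mono hx.cfcHom fun t => hfg t t.2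

theorem jointCFC_nonneg (hx : IsCommSelfAdjoint x) (hf : ContinuousOn f (specBox x))
    (hf₀ : ∀ t ∈ specBox x, 0 ≤ f t) : 0 ≤ jointCFC x f := by
  rw [hx.jointCFC_eq_cfcHom hf]
  exact map_nonneg hx.cfcHom fun t => hf₀ t t.2

end IsCommSelfAdjoint
end Calculus

/-! ### Unital algebras -/

section Tuples

theorem exists_affine_le_and_lt {E : Type*} [NormedAddCommGroup E] [NormedSpace ℝ E] {K : Set E}
    (hK : IsClosed K) {f : E → ℝ} (hf : ContinuousOn f K) (hconv : ConvexOn ℝ K f) {t : E}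
    (ht : t ∈ K) {r : ℝ} (hr : r < f t) :
    ∃ (l : E →L[ℝ] ℝ) (c : ℝ), (∀ s ∈ K, l s + c ≤ f s) ∧ r < l t + c := by
  obtain ⟨r', hrr', hr'⟩ := exists_between hr
  obtain ⟨l, c, hle, heq⟩ := hconv.exists_affine_le_of_lt (𝕜 := ℝ) ht hr' hK
    hf.lowerSemicontinuousOn
  exact ⟨l, c, fun s hs => hle ⟨s, hs⟩, hrr'.trans_eq heq.symm⟩

variable {n : ℕ}

theorem exists_subset_Icc_subset {K I : Set ℝ} (hK : IsCompact K) (hI : I.OrdConnected)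
    (hKI : K ⊆ I) : ∃ m M, K ⊆ Set.Icc m M ∧ Set.Icc m M ⊆ I := by
  obtain rfl | hne := K.eq_empty_or_nonempty
  · exact ⟨1, 0, Set.empty_subset _, by simp only [Set.Icc_eq_empty_iff.mpr, zero_lt_one, not_le,
      Set.empty_subset]⟩
  · exact ⟨sInf K, sSup K, hK.isBounded.subset_Icc_sInf_sSup,
      hI.out (hKI (hK.sInf_mem hne)) (hKI (hK.sSup_mem hne))⟩

theorem MutuallyCommuting.isCommSelfAdjoint {A : Type*} [NonUnitalCStarAlgebra A]
    {S : Fin n → NonUnitalStarSubalgebra ℂ A} (hS : MutuallyCommuting S) {x : Fin n → A}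
    (hx : ∀ i, x i ∈ S i) (hsa : ∀ i, IsSelfAdjoint (x i)) : IsCommSelfAdjoint x where
  isSelfAdjoint := hsa
  commute i j := by
    obtain rfl | hij := eq_or_ne i j
    · exact Commute.refl _
    · exact hS i j hij _ (hx i) _ (hx j)

variable {A : Type*} [CStarAlgebra A] {S : Fin n → NonUnitalStarSubalgebra ℂ A}

theorem specBox_subset_of_mem_saTuples {I : Fin n → Set ℝ} {x : Fin n → A}
    (hx : x ∈ saTuples S I) : specBox x ⊆ Set.univ.pi I :=
  Set.pi_mono fun i _ => (hx i).2.2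

theorem saTuples_mono {I J : Fin n → Set ℝ} (h : ∀ i, I i ⊆ J i) : saTuples S I ⊆ saTuples S J :=
  fun _ hx i => ⟨(hx i).1, (hx i).2.1, (hx i).2.2.trans (h i)⟩

theorem convexOn_saTuples_of_forall_Icc {𝕜 β : Type*} [Semiring 𝕜] [PartialOrder 𝕜] [SMul 𝕜 A]
    [AddCommMonoid β] [PartialOrder β] [SMul 𝕜 β] {I : Fin n → Set ℝ}
    (hI : ∀ i, (I i).OrdConnected) {F : (Fin n → A) → β}
    (hF : ∀ m M : Fin n → ℝ, (∀ i, Set.Icc (m i) (M i) ⊆ I i) →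
      ConvexOn 𝕜 (saTuples S fun i => Set.Icc (m i) (M i)) F) : ConvexOn 𝕜 (saTuples S I) F := by
  have hbox : ∀ x ∈ saTuples S I, ∀ y ∈ saTuples S I, ∃ m M : Fin n → ℝ,
      (∀ i, Set.Icc (m i) (M i) ⊆ I i) ∧ x ∈ saTuples S (fun i => Set.Icc (m i) (M i)) ∧
        y ∈ saTuples S (fun i => Set.Icc (m i) (M i)) := by
    intro x hx y hy
    choose m M hsub hI using fun i => exists_subset_Icc_subset
      ((spectrum.isCompact (x i)).union (spectrum.isCompact (y i))) (hI i)
      (Set.union_subset (hx i).2.2 (hy i).2.2)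
    exact ⟨m, M, hI, fun i => ⟨(hx i).1, (hx i).2.1, Set.subset_union_left.trans (hsub i)⟩,
      fun i => ⟨(hy i).1, (hy i).2.1, Set.subset_union_right.trans (hsub i)⟩⟩
  refine ⟨fun x hx y hy a b ha hb hab => ?_, fun x hx y hy a b ha hb hab => ?_⟩ <;>
    obtain ⟨m, M, hI, hx, hy⟩ := hbox x hx y hy
  · exact saTuples_mono hI ((hF m M hI).1 hx hy ha hb hab)
  · exact (hF m M hI).2 hx hy ha hb hab

variable [PartialOrder A] [StarOrderedRing A]

theorem convex_saTuples_Icc (S : Fin n → NonUnitalStarSubalgebra ℂ A) (m M : Fin n → ℝ) :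
    Convex ℝ (saTuples S fun i => Set.Icc (m i) (M i)) := by
  have hspec : ∀ {a : A} {r s : ℝ}, IsSelfAdjoint a →
      (spectrum ℝ a ⊆ Set.Icc r s ↔ a ∈ Set.Icc (algebraMap ℝ A r) (algebraMap ℝ A s)) :=
    fun ha => by
      rw [Set.mem_Icc, algebraMap_le_iff_le_spectrum ha, le_algebraMap_iff_spectrum_le ha,
        ← forall₂_and]
      rfl
  have heq : saTuples S (fun i => Set.Icc (m i) (M i)) = Set.univ.pi fun i =>
      ((S i).toSubmodule.restrictScalars ℝ : Set A) ∩ (selfAdjoint.submodule ℝ A ∩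
        Set.Icc (algebraMap ℝ A (m i)) (algebraMap ℝ A (M i))) := by
    ext x
    simp only [Set.mem_univ_pi]
    exact forall_congr' fun i => and_congr_right fun _ => and_congr_right hspec
  rw [heq]
  exact convex_pi fun i _ =>
    (Submodule.convex _).inter ((Submodule.convex _).inter (convex_Icc _ _))

variable {τ : A → ℝ≥0∞} {f : (Fin n → ℝ) → ℝ}

theorem IsTrace.map_jointCFC_smul_add_smul_le (hτ : IsTrace τ)
    (hlsc : LowerSemicontinuousOn τ {a | 0 ≤ a}) {x y : Fin n → A} {a b : ℝ≥0}
    (hx : IsCommSelfAdjoint x) (hy : IsCommSelfAdjoint y) (hz : IsCommSelfAdjoint (a • x + b • y))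
    (hab : a + b = 1) {K : Set (Fin n → ℝ)} (hxK : specBox x ⊆ K) (hyK : specBox y ⊆ K)
    (hzK : specBox (a • x + b • y) ⊆ K) (hK : IsClosed K) (hf : ContinuousOn f K)
    (hconv : ConvexOn ℝ K f) (hf₀ : ∀ t ∈ K, 0 ≤ f t) :
    τ (jointCFC (a • x + b • y) f) ≤ τ (a • jointCFC x f + b • jointCFC y f) := by
  have : CompactSpace (specBox (a • x + b • y)) :=
    isCompact_iff_compactSpace.mp (isCompact_specBox _)
  have hnonneg : ∀ {w : Fin n → A}, IsCommSelfAdjoint w → specBox w ⊆ K → 0 ≤ jointCFC w f :=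
    fun hw hwK => hw.jointCFC_nonneg (hf.mono hwK) fun t ht => hf₀ t (hwK ht)
  let L : Set C(specBox (a • x + b • y), ℝ) :=
    {g | ∃ (l : (Fin n → ℝ) →L[ℝ] ℝ) (c : ℝ), (∀ t ∈ K, l t + c ≤ f t) ∧ ∀ t, g t = l t + c}
  have hL : ∀ g ∈ L, hz.cfcHom g ≤ a • jointCFC x f + b • jointCFC y f := by
    rintro g ⟨l, c, hlf, hg⟩
    have hmono : ∀ {w : Fin n → A}, IsCommSelfAdjoint w → specBox w ⊆ K →
        jointCFC w (fun t => l t + c) ≤ jointCFC w f := fun hw hwK =>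
      hw.jointCFC_mono (by fun_prop) (hf.mono hwK) fun t ht => hlf t (hwK ht)
    calc hz.cfcHom g = jointCFC (a • x + b • y) fun t => l t + c := by
          rw [hz.jointCFC_eq_cfcHom (by fun_prop)]
          exact congrArg hz.cfcHom (ContinuousMap.ext hg)
      _ = a • jointCFC x (fun t => l t + c) + b • jointCFC y (fun t => l t + c) :=
          hx.jointCFC_affine_smul_add_smul hy hz hab l c
      _ ≤ a • jointCFC x f + b • jointCFC y f :=
          add_le_add (smul_le_smul_of_nonneg_left (hmono hx hxK) zero_le)
            (smul_le_smul_of_nonneg_left (hmono hy hyK) zero_le)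
  rw [hz.jointCFC_eq_cfcHom (hf.mono hzK)]
  refine hτ.map_le_of_forall_exists_lt hlsc
    (add_nonneg (smul_nonneg zero_le (hnonneg hx hxK)) (smul_nonneg zero_le (hnonneg hy hyK))) hL
    (fun t => hf₀ t (hzK t.2)) fun t r hr => ?_
  obtain ⟨l, c, hlf, hrl⟩ := exists_affine_le_and_lt hK hf hconv (hzK t.2) hr
  exact ⟨⟨fun t => l t + c, by fun_prop⟩, ⟨l, c, hlf, fun _ => rfl⟩, hrl⟩

theorem IsTrace.convexOn_jointCFC_of_isClosed (hτ : IsTrace τ)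
    (hlsc : LowerSemicontinuousOn τ {a | 0 ≤ a}) (hS : MutuallyCommuting S) {J : Fin n → Set ℝ}
    (hJ : ∀ i, IsClosed (J i)) (hSJ : Convex ℝ (saTuples S J))
    (hf : ContinuousOn f (Set.univ.pi J)) (hconv : ConvexOn ℝ (Set.univ.pi J) f)
    (hf₀ : ∀ t ∈ Set.univ.pi J, 0 ≤ f t) :
    ConvexOn ℝ≥0 (saTuples S J) fun x => τ (jointCFC x f) := by
  have hSJ : Convex ℝ≥0 (saTuples S J) := NNReal.convex_iff.mpr hSJ
  have hcomm : ∀ w ∈ saTuples S J, IsCommSelfAdjoint w := fun w hw =>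
    hS.isCommSelfAdjoint (fun i => (hw i).1) fun i => (hw i).2.1
  have hnonneg : ∀ w ∈ saTuples S J, 0 ≤ jointCFC w f := fun w hw =>
    (hcomm w hw).jointCFC_nonneg (hf.mono (specBox_subset_of_mem_saTuples hw))
      fun t ht => hf₀ t (specBox_subset_of_mem_saTuples hw ht)
  refine ⟨hSJ, fun x hx y hy a b _ _ hab => ?_⟩
  have hz := hSJ hx hy zero_le zero_le hab
  calc τ (jointCFC (a • x + b • y) f) ≤ τ (a • jointCFC x f + b • jointCFC y f) :=
        hτ.map_jointCFC_smul_add_smul_le hlsc (hcomm x hx) (hcomm y hy) (hcomm _ hz) hab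
          (specBox_subset_of_mem_saTuples hx) (specBox_subset_of_mem_saTuples hy)
          (specBox_subset_of_mem_saTuples hz) (isClosed_set_pi fun i _ => hJ i) hf hconv hf₀
    _ = a • τ (jointCFC x f) + b • τ (jointCFC y f) := by
        rw [hτ.map_add _ _ (smul_nonneg zero_le (hnonneg x hx))
          (smul_nonneg zero_le (hnonneg y hy)), hτ.map_smul _ _ (hnonneg x hx),
          hτ.map_smul _ _ (hnonneg y hy)]
        rfl

theorem IsTrace.convexOn_jointCFC (hτ : IsTrace τ) (hlsc : LowerSemicontinuousOn τ {a | 0 ≤ a})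
    (hS : MutuallyCommuting S) {I : Fin n → Set ℝ} (hI : ∀ i, (I i).OrdConnected)
    (hf : ContinuousOn f (Set.univ.pi I)) (hconv : ConvexOn ℝ (Set.univ.pi I) f)
    (hf₀ : ∀ t ∈ Set.univ.pi I, 0 ≤ f t) :
    ConvexOn ℝ≥0 (saTuples S I) fun x => τ (jointCFC x f) := by
  refine convexOn_saTuples_of_forall_Icc hI fun m M hsub => ?_
  have hpi := Set.pi_mono fun i (_ : i ∈ Set.univ) => hsub i
  exact hτ.convexOn_jointCFC_of_isClosed hlsc hS (fun i => isClosed_Icc)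
    (convex_saTuples_Icc S m M) (hf.mono hpi)
    (hconv.subset hpi (convex_pi fun i _ => convex_Icc _ _)) fun t ht => hf₀ t (hpi ht)

end Tuples

/-! ### Finite traces -/

section Finite

variable {A : Type*} [NonUnitalCStarAlgebra A] [PartialOrder A] {τ : A → ℝ≥0∞}

theorem IsTrace.toReal_map_add (hτ : IsTrace τ) (hfin : IsFiniteTrace τ) {a b : A} (ha : 0 ≤ a)
    (hb : 0 ≤ b) : (τ (a + b)).toReal = (τ a).toReal + (τ b).toReal := by
  rw [hτ.map_add a b ha hb, ENNReal.toReal_add (hfin a ha).ne (hfin b hb).ne]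

variable [StarOrderedRing A]

theorem IsTrace.realTrace_of_nonneg (hτ : IsTrace τ) {a : A} (ha : 0 ≤ a) :
    realTrace τ a = (τ a).toReal := by
  rw [realTrace, (CFC.posPart_eq_self a).mpr ha, (CFC.negPart_eq_zero_iff a).mpr ha, hτ.map_zero,
    ENNReal.toReal_zero, sub_zero]

theorem IsTrace.realTrace_sub_of_nonneg (hτ : IsTrace τ) (hfin : IsFiniteTrace τ) {p q : A}
    (hp : 0 ≤ p) (hq : 0 ≤ q) : realTrace τ (p - q) = (τ p).toReal - (τ q).toReal := by
  have hparts : (p - q)⁺ + q = p + (p - q)⁻ := by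
    rw [← sub_eq_sub_iff_add_eq_add]
    exact CFC.posPart_sub_negPart _ ((IsSelfAdjoint.of_nonneg hp).sub (.of_nonneg hq))
  have htrace := congrArg (fun a => (τ a).toReal) hparts
  rw [hτ.toReal_map_add hfin (CFC.posPart_nonneg _) hq,
    hτ.toReal_map_add hfin hp (CFC.negPart_nonneg _)] at htrace
  rw [realTrace]
  linarith

theorem IsTrace.realTrace_add (hτ : IsTrace τ) (hfin : IsFiniteTrace τ) {a b : A}
    (ha : IsSelfAdjoint a) (hb : IsSelfAdjoint b) :
    realTrace τ (a + b) = realTrace τ a + realTrace τ b := by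
  have hparts : a + b = (a⁺ + b⁺) - (a⁻ + b⁻) := by
    rw [add_sub_add_comm, CFC.posPart_sub_negPart a ha, CFC.posPart_sub_negPart b hb]
  rw [hparts, hτ.realTrace_sub_of_nonneg hfin
      (add_nonneg (CFC.posPart_nonneg _) (CFC.posPart_nonneg _))
      (add_nonneg (CFC.negPart_nonneg _) (CFC.negPart_nonneg _)),
    hτ.toReal_map_add hfin (CFC.posPart_nonneg _) (CFC.posPart_nonneg _),
    hτ.toReal_map_add hfin (CFC.negPart_nonneg _) (CFC.negPart_nonneg _), realTrace, realTrace]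
  ring

theorem IsTrace.realTrace_smul (hτ : IsTrace τ) (c : ℝ) (a : A) :
    realTrace τ (c • a) = c * realTrace τ a := by
  have hpos : ∀ {r : ℝ} {p : A}, 0 ≤ r → 0 ≤ p → (τ (r • p)).toReal = r * (τ p).toReal := by
    intro r p hr hp
    lift r to ℝ≥0 using hr
    exact (congrArg ENNReal.toReal (hτ.map_smul r p hp)).trans ENNReal.toReal_mul
  obtain hc | hc := le_total 0 c
  · rw [realTrace, CFC.posPart_smul_of_nonneg hc, CFC.negPart_smul_of_nonneg hc,
      hpos hc (CFC.posPart_nonneg a), hpos hc (CFC.negPart_nonneg a), realTrace, mul_sub]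
  · rw [realTrace, CFC.posPart_smul_of_nonpos hc, CFC.negPart_smul_of_nonpos hc,
      hpos (neg_nonneg.mpr hc) (CFC.posPart_nonneg a),
      hpos (neg_nonneg.mpr hc) (CFC.negPart_nonneg a), realTrace]
    ring

open ComplexOrder ComplexStarModule in
theorem IsTrace.exists_positiveLinearMap (hτ : IsTrace τ) (hfin : IsFiniteTrace τ) :
    ∃ φ : A →ₚ[ℂ] ℂ, ∀ a, IsSelfAdjoint a → φ a = realTrace τ a := by
  let ψ : selfAdjoint A →ₗ[ℝ] ℝ :=
    { toFun := fun a => realTrace τ (a : A)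
      map_add' := fun a b => hτ.realTrace_add hfin a.2 b.2
      map_smul' := fun c a => hτ.realTrace_smul c a }
  let φ : A →ₗ[ℂ] ℂ := Module.Dual.extendRCLike (𝕜 := ℂ) (ψ ∘ₗ realPart)
  have hφ : ∀ a, IsSelfAdjoint a → φ a = realTrace τ a := by
    intro a ha
    have hre : ψ (ℜ a) = realTrace τ a := congrArg (realTrace τ) ha.coe_realPart
    have him : ψ (ℜ (Complex.I • a)) = 0 := by
      rw [realPart_I_smul, ha.imaginaryPart, neg_zero, map_zero]
    calc φ a = ψ (ℜ a) - Complex.I * ψ (ℜ (Complex.I • a)) :=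
          Module.Dual.extendRCLike_apply (𝕜 := ℂ) _ a
      _ = realTrace τ a := by rw [hre, him, Complex.ofReal_zero, mul_zero, sub_zero]
  refine ⟨PositiveLinearMap.mk₀ φ fun a ha => ?_, hφ⟩
  rw [hφ a (.of_nonneg ha), hτ.realTrace_of_nonneg ha]
  exact Complex.zero_le_real.mpr ENNReal.toReal_nonneg

open ComplexOrder in
theorem IsTrace.lowerSemicontinuousOn_of_isFiniteTrace (hτ : IsTrace τ) (hfin : IsFiniteTrace τ) :
    LowerSemicontinuousOn τ {a | 0 ≤ a} := by
  obtain ⟨φ, hφ⟩ := hτ.exists_positiveLinearMap hfin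
  have heq : ∀ a : A, 0 ≤ a → ENNReal.ofReal (φ a).re = τ a := fun a ha => by
    rw [hφ a (.of_nonneg ha), Complex.ofReal_re, hτ.realTrace_of_nonneg ha,
      ENNReal.ofReal_toReal (hfin a ha).ne]
  have hcont : Continuous fun a => ENNReal.ofReal (φ a).re :=
    ENNReal.continuous_ofReal.comp (Complex.continuous_re.comp (map_continuous φ))
  exact (hcont.continuousOn.congr fun a ha => (heq a ha).symm).lowerSemicontinuousOn

end Finite

theorem convexOn_toReal_of_ne_top {E : Type*} [AddCommMonoid E] [Module ℝ E] {s : Set E}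
    {F : E → ℝ≥0∞} (hF : ConvexOn ℝ≥0 s F) (htop : ∀ x ∈ s, F x ≠ ∞) :
    ConvexOn ℝ s fun x => (F x).toReal := by
  refine ⟨NNReal.convex_iff.mp hF.1, fun x hx y hy a b ha hb hab => ?_⟩
  lift a to ℝ≥0 using ha
  lift b to ℝ≥0 using hb
  have hab : a + b = 1 := by exact_mod_cast hab
  have htop' : ∀ (c : ℝ≥0), ∀ w ∈ s, c • F w ≠ ∞ := fun c w hw =>
    ENNReal.mul_ne_top ENNReal.coe_ne_top (htop w hw)
  calc (F (a • x + b • y)).toReal ≤ (a • F x + b • F y).toReal :=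
        ENNReal.toReal_mono (ENNReal.add_ne_top.mpr ⟨htop' a x hx, htop' b y hy⟩)
          (hF.2 hx hy zero_le zero_le hab)
    _ = (a : ℝ) • (F x).toReal + (b : ℝ) • (F y).toReal := by
        rw [ENNReal.toReal_add (htop' a x hx) (htop' b y hy), ENNReal.toReal_smul,
          ENNReal.toReal_smul]
        rfl

section Unital

variable {n : ℕ} {A : Type*} [CStarAlgebra A] [PartialOrder A] [StarOrderedRing A]
  {S : Fin n → NonUnitalStarSubalgebra ℂ A} {τ : A → ℝ≥0∞} {I : Fin n → Set ℝ}
  {f : (Fin n → ℝ) → ℝ}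

theorem IsTrace.realTrace_jointCFC_eq_add (hτ : IsTrace τ) (hfin : IsFiniteTrace τ)
    {x : Fin n → A} (hx : IsCommSelfAdjoint x) (hf : ContinuousOn f (specBox x)) {m : ℝ}
    (hm : ∀ t ∈ specBox x, m ≤ f t) :
    realTrace τ (jointCFC x f) = (τ (jointCFC x fun t => f t + -m)).toReal + m * (τ 1).toReal := by
  have hfm : ContinuousOn (fun t => f t + -m) (specBox x) := hf.add continuousOn_const
  have hsum : jointCFC x f = jointCFC x (fun t => f t + -m) + m • (1 : A) := by
    rw [hx.jointCFC_add hf continuousOn_const, hx.jointCFC_const, Algebra.algebraMap_eq_smul_one,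
      neg_smul, neg_add_cancel_right]
  rw [hsum, hτ.realTrace_add hfin (hx.isSelfAdjoint_jointCFC hfm)
      ((IsSelfAdjoint.all m).smul (.one A)), hτ.realTrace_smul,
    hτ.realTrace_of_nonneg zero_le_one, hτ.realTrace_of_nonneg
      (hx.jointCFC_nonneg hfm fun t ht => by linarith [hm t ht])]

theorem IsTrace.convexOn_realTrace_jointCFC_of_le (hτ : IsTrace τ) (hfin : IsFiniteTrace τ)
    (hS : MutuallyCommuting S) (hI : ∀ i, (I i).OrdConnected)
    (hf : ContinuousOn f (Set.univ.pi I)) (hconv : ConvexOn ℝ (Set.univ.pi I) f) {m : ℝ}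
    (hm : ∀ t ∈ Set.univ.pi I, m ≤ f t) :
    ConvexOn ℝ (saTuples S I) fun x => realTrace τ (jointCFC x f) := by
  have hfm : ContinuousOn (fun t => f t + -m) (Set.univ.pi I) := hf.add continuousOn_const
  have hfm₀ : ∀ t ∈ Set.univ.pi I, 0 ≤ f t + -m := fun t ht => by linarith [hm t ht]
  have hcomm : ∀ x ∈ saTuples S I, IsCommSelfAdjoint x := fun x hx =>
    hS.isCommSelfAdjoint (fun i => (hx i).1) fun i => (hx i).2.1
  have hspec : ∀ x ∈ saTuples S I, specBox x ⊆ Set.univ.pi I := fun _ =>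
    specBox_subset_of_mem_saTuples
  have hshift : ConvexOn ℝ≥0 (saTuples S I) fun x => τ (jointCFC x fun t => f t + -m) :=
    hτ.convexOn_jointCFC (hτ.lowerSemicontinuousOn_of_isFiniteTrace hfin) hS hI hfm
      (hconv.add_const (-m)) hfm₀
  have htop : ∀ x ∈ saTuples S I, τ (jointCFC x fun t => f t + -m) ≠ ∞ := fun x hx =>
    (hfin _ ((hcomm x hx).jointCFC_nonneg (hfm.mono (hspec x hx))
      fun t ht => hfm₀ t (hspec x hx ht))).ne
  refine ((convexOn_toReal_of_ne_top hshift htop).add_const (m * (τ 1).toReal)).congr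
    fun x hx => ?_
  exact (hτ.realTrace_jointCFC_eq_add hfin (hcomm x hx) (hf.mono (hspec x hx))
    fun t ht => hm t (hspec x hx ht)).symm

theorem IsTrace.convexOn_realTrace_jointCFC (hτ : IsTrace τ) (hfin : IsFiniteTrace τ)
    (hS : MutuallyCommuting S) (hI : ∀ i, (I i).OrdConnected)
    (hf : ContinuousOn f (Set.univ.pi I)) (hconv : ConvexOn ℝ (Set.univ.pi I) f) :
    ConvexOn ℝ (saTuples S I) fun x => realTrace τ (jointCFC x f) := by
  refine convexOn_saTuples_of_forall_Icc hI fun r s hsub => ?_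
  have hpi := Set.pi_mono fun i (_ : i ∈ Set.univ) => hsub i
  obtain ⟨m, hm⟩ := (isCompact_univ_pi fun i => isCompact_Icc).bddBelow_image (hf.mono hpi)
  exact hτ.convexOn_realTrace_jointCFC_of_le hfin hS (fun i => Set.ordConnected_Icc) (hf.mono hpi)
    (hconv.subset hpi (convex_pi fun i _ => convex_Icc _ _))
    fun t ht => hm (Set.mem_image_of_mem f ht)

end Unital

/-! ### Extending traces to the unitization -/

section Unitization

variable {A : Type*}

open Classical in
/-- The extension of a trace `τ` on `A` to the unitization by the value `∞` off `A`. It reduces the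
lower semicontinuous non-unital case to the unital one. -/
def extendTrace (τ : A → ℝ≥0∞) (b : Unitization ℂ A) : ℝ≥0∞ :=
  if b.fst = 0 then τ b.snd else ∞

theorem extendTrace_of_fst_eq_zero (τ : A → ℝ≥0∞) {b : Unitization ℂ A} (hb : b.fst = 0) :
    extendTrace τ b = τ b.snd := if_pos hb

theorem extendTrace_of_fst_ne_zero (τ : A → ℝ≥0∞) {b : Unitization ℂ A} (hb : b.fst ≠ 0) :
    extendTrace τ b = ∞ := if_neg hb

theorem inr_snd_of_fst_eq_zero {b : Unitization ℂ A} (hb : b.fst = 0) :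
    ((b.snd : A) : Unitization ℂ A) = b :=
  Unitization.ext hb.symm rfl

variable [NonUnitalCStarAlgebra A]

open ComplexOrder in
theorem fst_nonneg_of_nonneg {b : Unitization ℂ A} (hb : 0 ≤ b) : 0 ≤ b.fst := by
  obtain ⟨s, rfl⟩ := CStarAlgebra.nonneg_iff_eq_star_mul_self.mp hb
  rw [Unitization.fst_mul, Unitization.fst_star]
  exact star_mul_self_nonneg s.fst

theorem norm_negPart_le_of_nonneg_algebraMap_add_inr {a : A} (ha : IsSelfAdjoint a) {r : ℝ}
    (h : 0 ≤ algebraMap ℝ (Unitization ℂ A) r + a) : ‖a⁻‖ ≤ r := by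
  have hspec : ∀ t ∈ quasispectrum ℝ a, -r ≤ t := by
    rw [Unitization.quasispectrum_eq_spectrum_inr' ℝ ℂ, ← algebraMap_le_iff_le_spectrum (ha.inr ℂ),
      map_neg, neg_le_iff_add_nonneg']
    exact h
  refine norm_cfcₙ_le fun t ht => ?_
  rw [Real.norm_of_nonneg (negPart_nonneg t), negPart_def]
  exact sup_le (neg_le.mp (hspec t ht)) (neg_nonpos.mp (hspec 0 (quasispectrum.zero_mem ℝ a)))

theorem isTrace_ofReal_comp [PartialOrder A] {g : A →ₗ[ℝ] ℝ} (hg : ∀ a, 0 ≤ a → 0 ≤ g a)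
    (hcyc : ∀ a, g (star a * a) = g (a * star a)) : IsTrace fun a => ENNReal.ofReal (g a) where
  map_add a b ha hb := by rw [map_add, ENNReal.ofReal_add (hg a ha) (hg b hb)]
  map_smul c a _ := by
    rw [NNReal.smul_def, map_smul, smul_eq_mul, ENNReal.ofReal_mul c.coe_nonneg,
      ENNReal.ofReal_coe_nnreal]
  map_star_mul_self a := by rw [hcyc]

variable [PartialOrder A] [StarOrderedRing A] {τ : A → ℝ≥0∞}

theorem snd_nonneg_of_fst_eq_zero {b : Unitization ℂ A} (hb : 0 ≤ b) (hfst : b.fst = 0) :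
    0 ≤ b.snd := by
  rwa [← Unitization.inr_nonneg_iff, inr_snd_of_fst_eq_zero hfst]

open ComplexOrder in
theorem IsTrace.extendTrace (hτ : IsTrace τ) : IsTrace (extendTrace τ) where
  map_add a b ha hb := by
    have hsum : (a + b).fst = 0 ↔ a.fst = 0 ∧ b.fst = 0 :=
      add_eq_zero_iff_of_nonneg (fst_nonneg_of_nonneg ha) (fst_nonneg_of_nonneg hb)
    by_cases h : a.fst = 0 ∧ b.fst = 0
    · rw [extendTrace_of_fst_eq_zero τ h.1, extendTrace_of_fst_eq_zero τ h.2,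
        extendTrace_of_fst_eq_zero τ (hsum.mpr h), Unitization.snd_add,
        hτ.map_add _ _ (snd_nonneg_of_fst_eq_zero ha h.1) (snd_nonneg_of_fst_eq_zero hb h.2)]
    · rw [extendTrace_of_fst_ne_zero τ (hsum.not.mpr h), eq_comm, ENNReal.add_eq_top]
      exact (not_and_or.mp h).imp (extendTrace_of_fst_ne_zero τ) (extendTrace_of_fst_ne_zero τ)
  map_smul c a ha := by
    obtain rfl | hc := eq_or_ne c 0
    · rw [zero_smul, extendTrace_of_fst_eq_zero τ Unitization.fst_zero, Unitization.snd_zero,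
        hτ.map_zero, ENNReal.coe_zero, zero_mul]
    have hsmul : (c • a).fst = 0 ↔ a.fst = 0 := by
      rw [Unitization.fst_smul, smul_eq_zero_iff_right hc]
    by_cases h : a.fst = 0
    · rw [extendTrace_of_fst_eq_zero τ h, extendTrace_of_fst_eq_zero τ (hsmul.mpr h),
        Unitization.snd_smul, hτ.map_smul _ _ (snd_nonneg_of_fst_eq_zero ha h)]
    · rw [extendTrace_of_fst_ne_zero τ h, extendTrace_of_fst_ne_zero τ (hsmul.not.mpr h),
        ENNReal.mul_top (ENNReal.coe_ne_zero.mpr hc)]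
  map_star_mul_self b := by
    by_cases h : b.fst = 0
    · rw [← inr_snd_of_fst_eq_zero h, ← Unitization.inr_star, ← Unitization.inr_mul,
        ← Unitization.inr_mul, extendTrace_of_fst_eq_zero τ (Unitization.fst_inr ℂ _),
        extendTrace_of_fst_eq_zero τ (Unitization.fst_inr ℂ _)]
      exact hτ.map_star_mul_self b.snd
    · rw [extendTrace_of_fst_ne_zero τ (mul_ne_zero (star_ne_zero.mpr h) h),
        extendTrace_of_fst_ne_zero τ (mul_ne_zero h (star_ne_zero.mpr h))]

theorem lowerSemicontinuousOn_extendTrace (hlsc : LowerSemicontinuousOn τ {a | 0 ≤ a}) :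
    LowerSemicontinuousOn (extendTrace τ) {b | 0 ≤ b} := by
  intro b hb r hr
  by_cases h : b.fst = 0
  · rw [extendTrace_of_fst_eq_zero τ h] at hr
    have hsnd := hlsc _ (snd_nonneg_of_fst_eq_zero hb h) r hr
    rw [eventually_nhdsWithin_iff] at hsnd ⊢
    filter_upwards [Unitization.continuous_snd.continuousAt.eventually hsnd] with c hc hc₀
    by_cases hfst : c.fst = 0
    · rw [extendTrace_of_fst_eq_zero τ hfst]
      exact hc (snd_nonneg_of_fst_eq_zero hc₀ hfst)
    · rw [extendTrace_of_fst_ne_zero τ hfst]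
      exact hr.trans_le le_top
  · rw [extendTrace_of_fst_ne_zero τ h] at hr
    filter_upwards [mem_nhdsWithin_of_mem_nhds
      (Unitization.continuous_fst.continuousAt.eventually_ne h)] with c hc
    rwa [extendTrace_of_fst_ne_zero τ hc]

open ComplexOrder in
theorem mul_re_fst_add_re_snd_nonneg (φ : A →ₚ[ℂ] ℂ) {C : ℝ≥0} (hC : ∀ a, ‖φ a‖ ≤ C * ‖a‖)
    {b : Unitization ℂ A} (hb : 0 ≤ b) : 0 ≤ C * b.fst.re + (φ b.snd).re := by
  have hsnd : IsSelfAdjoint b.snd :=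
    congrArg (fun c : Unitization ℂ A => c.snd) (IsSelfAdjoint.of_nonneg hb).star_eq
  have hfst : (b.fst.re : ℂ) = b.fst :=
    (Complex.eq_re_of_ofReal_le (fst_nonneg_of_nonneg hb)).symm
  have hdecomp : algebraMap ℝ (Unitization ℂ A) b.fst.re + b.snd = b := by
    rw [IsScalarTower.algebraMap_apply ℝ ℂ, Complex.coe_algebraMap, hfst,
      Unitization.algebraMap_eq_inl, Unitization.inl_fst_add_inr_snd_eq]
  have hnorm : ‖b.snd⁻‖ ≤ b.fst.re :=
    norm_negPart_le_of_nonneg_algebraMap_add_inr hsnd (hdecomp.symm ▸ hb)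
  have hpos : 0 ≤ (φ b.snd⁺).re := (Complex.nonneg_iff.mp (map_nonneg φ (CFC.posPart_nonneg _))).1
  have hneg : (φ b.snd⁻).re ≤ C * b.fst.re :=
    calc (φ b.snd⁻).re ≤ ‖φ b.snd⁻‖ := Complex.re_le_norm _
      _ ≤ C * ‖b.snd⁻‖ := hC _
      _ ≤ C * b.fst.re := by gcongr
  have hsplit : (φ b.snd).re = (φ b.snd⁺).re - (φ b.snd⁻).re := by
    rw [← Complex.sub_re, ← map_sub, CFC.posPart_sub_negPart b.snd]
  linarith

open ComplexOrder in
theorem IsTrace.exists_extension_of_isFiniteTrace (hτ : IsTrace τ) (hfin : IsFiniteTrace τ) :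
    ∃ σ : Unitization ℂ A → ℝ≥0∞,
      IsTrace σ ∧ IsFiniteTrace σ ∧ ∀ a : A, 0 ≤ a → σ a = τ a := by
  obtain ⟨φ, hφ⟩ := hτ.exists_positiveLinearMap hfin
  obtain ⟨C, hC⟩ := φ.exists_norm_apply_le
  have hφ_nonneg : ∀ a, 0 ≤ a → φ a = (τ a).toReal := fun a ha => by
    rw [hφ a (.of_nonneg ha), hτ.realTrace_of_nonneg ha]
  have hcyc : ∀ a, φ (star a * a) = φ (a * star a) := fun a => by
    rw [hφ_nonneg _ (star_mul_self_nonneg a), hφ_nonneg _ (mul_star_self_nonneg a),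
      hτ.map_star_mul_self]
  let g : Unitization ℂ A →ₗ[ℝ] ℝ :=
    (C : ℝ) • Complex.reLm ∘ₗ (Unitization.fstHom ℂ A).toLinearMap.restrictScalars ℝ +
      Complex.reLm ∘ₗ φ.toLinearMap.restrictScalars ℝ ∘ₗ Unitization.sndHom ℝ ℂ A
  have hg : ∀ b, g b = C * b.fst.re + (φ b.snd).re := fun _ => rfl
  refine ⟨fun b => ENNReal.ofReal (g b),
    isTrace_ofReal_comp (fun b hb => mul_re_fst_add_re_snd_nonneg φ hC hb) fun b => ?_,
    fun b _ => ENNReal.ofReal_lt_top, fun a ha => ?_⟩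
  · rw [hg, hg, Unitization.fst_mul, Unitization.fst_mul, Unitization.snd_mul, Unitization.snd_mul,
      _root_.map_add, _root_.map_add, _root_.map_add, _root_.map_add, Unitization.snd_star,
      hcyc, mul_comm b.fst, add_comm (φ (_ • b.snd))]
  · simp only [hg, Unitization.fst_inr, Unitization.snd_inr, hφ_nonneg a ha, Complex.zero_re,
      mul_zero, zero_add, Complex.ofReal_re, ENNReal.ofReal_toReal (hfin a ha).ne]

theorem realTrace_inr {σ : Unitization ℂ A → ℝ≥0∞} (hσ : IsTrace σ) (hfin : IsFiniteTrace σ)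
    (hστ : ∀ a : A, 0 ≤ a → σ a = τ a) {a : A} (ha : IsSelfAdjoint a) :
    realTrace σ (a : Unitization ℂ A) = realTrace τ a := by
  have hparts : (a : Unitization ℂ A) = (a⁺ : A) - (a⁻ : A) := by
    rw [← Unitization.inr_sub, CFC.posPart_sub_negPart a ha]
  rw [hparts, hσ.realTrace_sub_of_nonneg hfin
      (Unitization.inr_nonneg_iff.mpr (CFC.posPart_nonneg a))
      (Unitization.inr_nonneg_iff.mpr (CFC.negPart_nonneg a)),
    hστ _ (CFC.posPart_nonneg a), hστ _ (CFC.negPart_nonneg a), realTrace]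

end Unitization

/-! ### Algebras without unit -/

section NonUnitalTuples

variable {n : ℕ} {A : Type*} [NonUnitalCStarAlgebra A] {S : Fin n → NonUnitalStarSubalgebra ℂ A}
  {I : Fin n → Set ℝ} {f : (Fin n → ℝ) → ℝ}

theorem mem_saTuplesₙ_iff_inr {x : Fin n → A} :
    x ∈ saTuplesₙ S I ↔ (fun i => (x i : Unitization ℂ A)) ∈
      saTuples (fun i => (S i).map (Unitization.inrNonUnitalStarAlgHom ℂ A)) I := by
  refine forall_congr' fun i => and_congr ?_ (and_congr ?_ ?_)
  · exact (Unitization.inr_injective.mem_set_image (s := (S i : Set A))).symm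
  · exact Unitization.isSelfAdjoint_inr.symm
  · rw [Unitization.quasispectrum_eq_spectrum_inr' ℝ ℂ]

theorem MutuallyCommuting.map_inr (hS : MutuallyCommuting S) :
    MutuallyCommuting fun i => (S i).map (Unitization.inrNonUnitalStarAlgHom ℂ A) := by
  rintro i j hij _ ⟨a, ha, rfl⟩ _ ⟨b, hb, rfl⟩
  exact (hS i j hij a ha b hb).map (Unitization.inrNonUnitalStarAlgHom ℂ A)

theorem convexOn_saTuplesₙ_of_saTuples {𝕜 β : Type*} [Semiring 𝕜] [PartialOrder 𝕜] [Module 𝕜 A]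
    [Module 𝕜 ℂ] [AddCommMonoid β] [PartialOrder β] [SMul 𝕜 β]
    {F : (Fin n → Unitization ℂ A) → β} (hF : ConvexOn 𝕜
      (saTuples (fun i => (S i).map (Unitization.inrNonUnitalStarAlgHom ℂ A)) I) F) :
    ConvexOn 𝕜 (saTuplesₙ S I) fun x => F fun i => (x i : Unitization ℂ A) := by
  have hpre : saTuplesₙ S I = (Unitization.inrHom 𝕜 ℂ A).compLeft (Fin n) ⁻¹'
      saTuples (fun i => (S i).map (Unitization.inrNonUnitalStarAlgHom ℂ A)) I :=
    Set.ext fun _ => mem_saTuplesₙ_iff_inr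
  rw [hpre]
  exact hF.comp_linearMap ((Unitization.inrHom 𝕜 ℂ A).compLeft (Fin n))

theorem inr_jointCFCₙ_of_mem_saTuplesₙ (hS : MutuallyCommuting S)
    (hf : ContinuousOn f (Set.univ.pi I)) (hf₀ : f 0 = 0) {x : Fin n → A}
    (hx : x ∈ saTuplesₙ S I) :
    ((jointCFCₙ x f : A) : Unitization ℂ A) = jointCFC (fun i => (x i : Unitization ℂ A)) f := by
  have hcomm := hS.isCommSelfAdjoint (fun i => (hx i).1) fun i => (hx i).2.1
  refine inr_snd_of_fst_eq_zero ?_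
  rw [fst_jointCFC_inr x hcomm.isSelfAdjoint hcomm.commute f
    (hf.mono (specBox_subset_of_mem_saTuples (mem_saTuplesₙ_iff_inr.mp hx))), hf₀,
    Complex.ofReal_zero]

theorem isSelfAdjoint_jointCFCₙ_of_mem_saTuplesₙ (hS : MutuallyCommuting S)
    (hf : ContinuousOn f (Set.univ.pi I)) (hf₀ : f 0 = 0) {x : Fin n → A}
    (hx : x ∈ saTuplesₙ S I) : IsSelfAdjoint (jointCFCₙ x f) := by
  have hx' := mem_saTuplesₙ_iff_inr.mp hx
  rw [← Unitization.isSelfAdjoint_inr (R := ℂ), inr_jointCFCₙ_of_mem_saTuplesₙ hS hf hf₀ hx]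
  exact (hS.map_inr.isCommSelfAdjoint (fun i => (hx' i).1)
    fun i => (hx' i).2.1).isSelfAdjoint_jointCFC (hf.mono (specBox_subset_of_mem_saTuples hx'))

variable [PartialOrder A] [StarOrderedRing A] {τ : A → ℝ≥0∞}

theorem IsTrace.convexOn_jointCFCₙ (hτ : IsTrace τ) (hlsc : LowerSemicontinuousOn τ {a | 0 ≤ a})
    (hS : MutuallyCommuting S) (hI : ∀ i, (I i).OrdConnected)
    (hf : ContinuousOn f (Set.univ.pi I)) (hconv : ConvexOn ℝ (Set.univ.pi I) f)
    (hf₀ : ∀ t ∈ Set.univ.pi I, 0 ≤ f t) (hzero : f 0 = 0) :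
    ConvexOn ℝ≥0 (saTuplesₙ S I) fun x => τ (jointCFCₙ x f) := by
  refine (convexOn_saTuplesₙ_of_saTuples (hτ.extendTrace.convexOn_jointCFC
    (lowerSemicontinuousOn_extendTrace hlsc) hS.map_inr hI hf hconv hf₀)).congr fun x hx => ?_
  beta_reduce
  rw [← inr_jointCFCₙ_of_mem_saTuplesₙ hS hf hzero hx,
    extendTrace_of_fst_eq_zero τ (Unitization.fst_inr ℂ _), Unitization.snd_inr]

theorem IsTrace.convexOn_realTrace_jointCFCₙ (hτ : IsTrace τ) (hfin : IsFiniteTrace τ)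
    (hS : MutuallyCommuting S) (hI : ∀ i, (I i).OrdConnected)
    (hf : ContinuousOn f (Set.univ.pi I)) (hconv : ConvexOn ℝ (Set.univ.pi I) f)
    (hzero : f 0 = 0) : ConvexOn ℝ (saTuplesₙ S I) fun x => realTrace τ (jointCFCₙ x f) := by
  obtain ⟨σ, hσ, hσfin, hστ⟩ := hτ.exists_extension_of_isFiniteTrace hfin
  refine (convexOn_saTuplesₙ_of_saTuples (hσ.convexOn_realTrace_jointCFC hσfin hS.map_inr hI hf
    hconv)).congr fun x hx => ?_
  beta_reduce
  rw [← inr_jointCFCₙ_of_mem_saTuplesₙ hS hf hzero hx, realTrace_inr hσ hσfin hστ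
    (isSelfAdjoint_jointCFCₙ_of_mem_saTuplesₙ hS hf hzero hx)]

end NonUnitalTuples

end TraceConvexity

end

open TraceConvexity in
theorem theorem2_general {n : ℕ} (I : Fin n → Set ℝ) (hI : ∀ i, (I i).OrdConnected)
    (f : (Fin n → ℝ) → ℝ) (hf : ContinuousOn f (Set.univ.pi I))
    (hconv : ConvexOn ℝ (Set.univ.pi I) f) :
    (∀ (A : Type*) [CStarAlgebra A] [PartialOrder A] [StarOrderedRing A]
      (S : Fin n → NonUnitalStarSubalgebra ℂ A), MutuallyCommuting S →
      ∀ τ : A → ℝ≥0∞, IsTrace τ →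
        (IsFiniteTrace τ →
          ConvexOn ℝ (saTuples S I) fun x => realTrace τ (jointCFC x f)) ∧
        (LowerSemicontinuousOn τ {a | 0 ≤ a} → (∀ t ∈ Set.univ.pi I, 0 ≤ f t) →
          ConvexOn ℝ≥0 (saTuples S I) fun x => τ (jointCFC x f))) ∧
    (f 0 = 0 → ∀ (A : Type*) [NonUnitalCStarAlgebra A] [PartialOrder A] [StarOrderedRing A]
      (S : Fin n → NonUnitalStarSubalgebra ℂ A), MutuallyCommuting S →
      ∀ τ : A → ℝ≥0∞, IsTrace τ →
        (IsFiniteTrace τ →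
          ConvexOn ℝ (saTuplesₙ S I) fun x => realTrace τ (jointCFCₙ x f)) ∧
        (LowerSemicontinuousOn τ {a | 0 ≤ a} → (∀ t ∈ Set.univ.pi I, 0 ≤ f t) →
          ConvexOn ℝ≥0 (saTuplesₙ S I) fun x => τ (jointCFCₙ x f))) :=
  ⟨fun _ _ _ _ _ hS _ hτ =>
    ⟨fun hfin => hτ.convexOn_realTrace_jointCFC hfin hS hI hf hconv,
      fun hlsc hf₀ => hτ.convexOn_jointCFC hlsc hS hI hf hconv hf₀⟩,
  fun hzero _ _ _ _ _ hS _ hτ =>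
    ⟨fun hfin => hτ.convexOn_realTrace_jointCFCₙ hfin hS hI hf hconv hzero,
      fun hlsc hf₀ => hτ.convexOn_jointCFCₙ hlsc hS hI hf hconv hf₀ hzero⟩⟩

open TraceConvexity in
theorem theorem2 {n : ℕ} (I : Fin n → Set ℝ) (hI : ∀ i, (I i).OrdConnected)
    (f : (Fin n → ℝ) → ℝ) (hf : ContinuousOn f (Set.univ.pi I))
    (hconv : ConvexOn ℝ (Set.univ.pi I) f) :
    -- unital C⋆-algebras
    (∀ (A : Type*) [CStarAlgebra A] [PartialOrder A] [StarOrderedRing A]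
      (S : Fin n → NonUnitalStarSubalgebra ℂ A), (∀ i, IsClosed (S i : Set A)) →
      MutuallyCommuting S → ∀ τ : A → ℝ≥0∞, IsTrace τ →
        (IsFiniteTrace τ →
          ConvexOn ℝ (saTuples S I) fun x => realTrace τ (jointCFC x f)) ∧
        (IsDenselyDefined τ → LowerSemicontinuousOn τ {a | 0 ≤ a} →
          (∀ t ∈ Set.univ.pi I, 0 ≤ f t) →
          ConvexOn ℝ≥0 (saTuples S I) fun x => τ (jointCFC x f))) ∧
    -- C⋆-algebras without unit, where `f(x) ∈ A` requires `f 0 = 0`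
    (f 0 = 0 → ∀ (A : Type*) [NonUnitalCStarAlgebra A] [PartialOrder A] [StarOrderedRing A]
      (S : Fin n → NonUnitalStarSubalgebra ℂ A), (∀ i, IsClosed (S i : Set A)) →
      MutuallyCommuting S → ∀ τ : A → ℝ≥0∞, IsTrace τ →
        (IsFiniteTrace τ →
          ConvexOn ℝ (saTuplesₙ S I) fun x => realTrace τ (jointCFCₙ x f)) ∧
        (IsDenselyDefined τ → LowerSemicontinuousOn τ {a | 0 ≤ a} →
          (∀ t ∈ Set.univ.pi I, 0 ≤ f t) →
          ConvexOn ℝ≥0 (saTuplesₙ S I) fun x => τ (jointCFCₙ x f))) :=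
  have hgen := theorem2_general I hI f hf hconv
  ⟨fun A _ _ _ S _ hS τ hτ => (hgen.1 A S hS τ hτ).imp_right fun h _ => h,
    fun hzero A _ _ _ S _ hS τ hτ => (hgen.2 hzero A S hS τ hτ).imp_right fun h _ => h⟩
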